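/- **Corollary 1 (symmetric unstable networks).** Consider a network with $n$ nodes and dynamics $x_{t+1} = Ax_t + B_S u_t$, where $A\in\mathbb{R}^{n\times n}$ is the dynamics matrix, $S \subseteq \{e_1,\dots,e_n\}$ is a non-empty set of standard unit vectors (the actuated nodes) and $B_S\in\mathbb{R}^{n\times|S|}$ is the matrix whose columns are the elements of $S$. Suppose that $A$ is symmetric and Schur unstable, i.e. some eigenvalue has modulus greater than $1$. Let $\lambda_{\max}(A)$ be an eigenvalue of $A$ of maximum modulus, let $\bar\lambda_u$ be an eigenvalue of minimum modulus among the eigenvalues of $A$ of modulus greater than $1$, and let $\bar n$ be the number of eigenvalues of $A$, counted with multiplicity, of modulus at least $|\bar\lambda_u|$ (that is, the number of unstable eigenvalues). Let $Q \succeq 0$ be such that $(A, Q^{1/2})$ is detectable (there is a matrix $L$ such that all eigenvalues of $A - LQ^{1/2}$ have modulus less than $1$), and let $P \succeq 0$ be the optimal cost matrix of the infinite-horizon linear-quadratic regulator with state cost $Q$ and input cost $I$, that is, a positive semidefinite solution of the algebraic Riccati equation $$P = Q + A^T P A - A^T P B_S (I + B_S^T P B_S)^{-1} B_S^T P A.$$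 Then the largest eigenvalue of $P$ satisfies $$\lambda_{\max}(P) \;\ge\; \max\left\{ \frac{\lambda_{\max}(A)^2-1}{\lambda_{\max}(A)^2},\ \ \frac{\bar\lambda_u^2-1}{\bar\lambda_u^2}\,|\bar\lambda_u|^{\,2\left(\frac{\bar n}{|S|}-1\right)} \right\}.$$ -/

import Mathlib

open scoped MatrixOrder

noncomputable section

/-- The spectrum of a real square matrix: all its (complex) eigenvalues, with multiplicity. -/
def spec {V : Type*} [Fintype V] [DecidableEq V] (M : Matrix V V ℝ) : Multiset ℂ :=
  (M.map (algebraMap ℝ ℂ)).charpoly.roots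

/-- Schur stability: all eigenvalues lie in the open unit disc. -/
def IsSchurStable {V : Type*} [Fintype V] [DecidableEq V] (M : Matrix V V ℝ) : Prop :=
  ∀ z ∈ spec M, ‖z‖ < 1

/-- Schur instability: some eigenvalue has modulus larger than one. -/
def IsSchurUnstable {V : Type*} [Fintype V] [DecidableEq V] (M : Matrix V V ℝ) : Prop :=
  ∃ z ∈ spec M, 1 < ‖z‖

/-- `l` is a (real) eigenvalue of `M` of maximum modulus: `l = λ_max(M)`. -/
def IsMaxEigenvalue {V : Type*} [Fintype V] [DecidableEq V] (M : Matrix V V ℝ) (l : ℝ) : Prop :=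
  (l : ℂ) ∈ spec M ∧ ∀ z ∈ spec M, ‖z‖ ≤ |l|

/-- `l` is a (real) unstable eigenvalue of `M` of minimum modulus among the unstable
eigenvalues of `M`. -/
def IsMinUnstableEigenvalue {V : Type*} [Fintype V] [DecidableEq V] (M : Matrix V V ℝ)
    (l : ℝ) : Prop :=
  (l : ℂ) ∈ spec M ∧ 1 < |l| ∧ ∀ z ∈ spec M, 1 < ‖z‖ → |l| ≤ ‖z‖

/-- The number of eigenvalues of `M`, counted with multiplicity, of modulus at least `η`. -/
def numEigenvaluesGE {V : Type*} [Fintype V] [DecidableEq V] (M : Matrix V V ℝ) (η : ℝ) : ℕ :=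
  ((spec M).filter (fun z => η ≤ ‖z‖)).card

/-- The pair `(A, C)` is detectable: some output injection makes `A - L C` Schur stable. -/
def IsDetectable {V W : Type*} [Fintype V] [DecidableEq V] [Fintype W]
    (A : Matrix V V ℝ) (C : Matrix W V ℝ) : Prop :=
  ∃ L : Matrix V W ℝ, IsSchurStable (A - L * C)

/-- The input matrix `B_S`, whose columns are the unit vectors `e_j` with `j ∈ S`. -/
def inputMatrix {V : Type*} [DecidableEq V] (S : Finset V) : Matrix V S ℝ :=
  Matrix.of fun i j => if i = (j : V) then 1 else 0

/-- `P` satisfies the discrete-time algebraic Riccati equation for dynamics matrix `A`, input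
matrix `B`, state cost matrix `Q` and input cost matrix `R`. -/
def SolvesRiccati {V W : Type*} [Fintype V] [Fintype W] [DecidableEq W]
    (A : Matrix V V ℝ) (B : Matrix V W ℝ) (Q : Matrix V V ℝ) (R : Matrix W W ℝ)
    (P : Matrix V V ℝ) : Prop :=
  P = Q + A.transpose * P * A
    - A.transpose * P * B * (R + B.transpose * P * B)⁻¹ * B.transpose * P * A

end

open scoped Matrix
open Filter Topology

/-! The Riccati equation provides a feedback trajectory from any `x₀` with total cost at most `x₀ᵀ P
x₀ ≤ λ_max(P) |x₀|²`. Finite cost and detectability keep the state bounded. Test it against a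
backward orbit `z t = A⁻ᵗ z 0` in the span of eigenvectors with `|λ| ≥ r > 1`: it decays like `r⁻ᵗ`,
so `z t ⬝ᵥ x t → 0`, while by symmetry of `A` this pairing changes only through `(Bᵀ z (t+1)) ⬝ᵥ u
t`. Cauchy–Schwarz then bounds the input energy from below
(`sq_dotProduct_le_of_adjoint_trajectory`).

With `k` such eigenvectors and `T |S| < k`, a dimension count (`exists_combination_eq_zero_on`)
gives `z 0 ≠ 0` that the actuators do not see for `T` steps. Taking `x₀ = z 0` yields `λ_max(P) ≥
(r² - 1) r^(2T)`, and both bounds are instances of this. -/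

/-! ### Spectral theorem and Rayleigh bound. -/

theorem spec_eq_map_eigenvalues {V : Type*} [Fintype V] [DecidableEq V] {A : Matrix V V ℝ}
    (hA : A.IsHermitian) :
    spec A = (Finset.univ : Finset V).val.map fun i => ((hA.eigenvalues i : ℝ) : ℂ) := by
  have h : (A.map (algebraMap ℝ ℂ)).charpoly =
      ∏ i, (Polynomial.X - Polynomial.C ((hA.eigenvalues i : ℝ) : ℂ)) := by
    rw [Matrix.charpoly_map, hA.charpoly_eq, Polynomial.map_prod]
    simp
  rw [spec, h, Polynomial.roots_prod _ _ (Finset.prod_ne_zero_iff.mpr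
    fun i _ => Polynomial.X_sub_C_ne_zero _)]
  simp [Multiset.bind_singleton]

/-- The spectral theorem for real symmetric matrices, in terms of the dot product. -/
theorem exists_orthonormal_eigenvectors {V : Type*} [Fintype V] [DecidableEq V]
    {A : Matrix V V ℝ} (hA : A.IsHermitian) :
    ∃ (l : V → ℝ) (v : V → V → ℝ), (∀ i, A *ᵥ v i = l i • v i) ∧
      (∀ i j, v i ⬝ᵥ v j = if i = j then 1 else 0) ∧
      (∀ x, ∑ i, (v i ⬝ᵥ x) • v i = x) ∧
      spec A = (Finset.univ : Finset V).val.map fun i => (l i : ℂ) := by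
  refine ⟨hA.eigenvalues, fun i => (hA.eigenvectorBasis i).ofLp,
    fun i => hA.mulVec_eigenvectorBasis i, fun i j => ?_, fun x => ?_, spec_eq_map_eigenvalues hA⟩
  · have h := orthonormal_iff_ite.mp hA.eigenvectorBasis.orthonormal i j
    rw [← h, dotProduct_comm]
    rfl
  · have h := congrArg WithLp.ofLp (hA.eigenvectorBasis.sum_repr' (WithLp.toLp 2 x))
    rw [WithLp.ofLp_sum] at h
    simp only [WithLp.ofLp_smul] at h
    refine Eq.trans (Finset.sum_congr rfl fun i _ => ?_) h
    rw [dotProduct_comm]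
    rfl

theorem dotProduct_mulVec_le_of_isMaxEigenvalue {V : Type*} [Fintype V] [DecidableEq V]
    {P : Matrix V V ℝ} (hP : P.PosSemidef) {l : ℝ} (hl : IsMaxEigenvalue P l) (x : V → ℝ) :
    x ⬝ᵥ P *ᵥ x ≤ l * (x ⬝ᵥ x) := by
  obtain ⟨e, v, he, -, hv, hs⟩ := exists_orthonormal_eigenvectors hP.1
  obtain ⟨hl1, hl2⟩ := hl
  rw [hs] at hl1 hl2
  -- Positivity turns the eigenvalue of maximum modulus into the largest one.
  have hl0 : 0 ≤ l := by
    rw [spec_eq_map_eigenvalues hP.1] at hs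
    rw [← hs] at hl1
    obtain ⟨i, -, hi⟩ := Multiset.mem_map.mp hl1
    have : hP.1.eigenvalues i = l := by exact_mod_cast hi
    rw [← this]
    exact hP.eigenvalues_nonneg i
  have hle : ∀ i, e i ≤ l := fun i => by
    have := hl2 (e i) (Multiset.mem_map.mpr ⟨i, Finset.mem_val.mpr (Finset.mem_univ i), rfl⟩)
    rw [Complex.norm_real, Real.norm_eq_abs, abs_of_nonneg hl0] at this
    exact (le_abs_self _).trans this
  have h1 : x ⬝ᵥ P *ᵥ x = ∑ i, e i * (v i ⬝ᵥ x) ^ 2 := by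
    conv_lhs => rw [← hv x, Matrix.mulVec_sum, dotProduct_sum, hv x]
    refine Finset.sum_congr rfl fun i _ => ?_
    rw [Matrix.mulVec_smul, he, dotProduct_smul, dotProduct_smul, dotProduct_comm x, smul_eq_mul,
      smul_eq_mul]
    ring
  have h2 : x ⬝ᵥ x = ∑ i, (v i ⬝ᵥ x) ^ 2 := by
    conv_lhs => rw [← hv x, dotProduct_sum, hv x]
    refine Finset.sum_congr rfl fun i _ => ?_
    rw [dotProduct_smul, dotProduct_comm x, smul_eq_mul]
    ring
  rw [h1, h2, Finset.mul_sum]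
  gcongr with i
  exact hle i

/-! ### Schur stability and detectability. -/

section Stability

open scoped Matrix.Norms.Operator

/-- Root test: by Gelfand's formula, `‖a ^ n‖` is eventually below `ρ ^ n` for some `ρ < 1`. -/
theorem summable_norm_pow_of_spectralRadius_lt_one {R : Type*} [NormedRing R] [NormedAlgebra ℂ R]
    [CompleteSpace R] {a : R} (ha : spectralRadius ℂ a < 1) : Summable fun n => ‖a ^ n‖ := by
  obtain ⟨ρ, h1, h2⟩ := ENNReal.lt_iff_exists_nnreal_btwn.mp ha
  have hρ : ρ < 1 := by exact_mod_cast h2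
  have hev := (spectrum.pow_nnnorm_pow_one_div_tendsto_nhds_spectralRadius a).eventually_lt_const h1
  have hg : Summable fun n : ℕ => (ρ : ℝ) ^ n := summable_geometric_of_lt_one ρ.2 hρ
  refine hg.of_norm_bounded_eventually_nat ?_
  filter_upwards [hev, eventually_gt_atTop 0] with n hn hn0
  have hn' : (0 : ℝ) < n := by exact_mod_cast hn0
  have h3 := ENNReal.rpow_le_rpow hn.le hn'.le
  rw [← ENNReal.rpow_mul, one_div_mul_cancel hn'.ne', ENNReal.rpow_one, ENNReal.rpow_natCast] at h3
  rw [norm_norm]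
  exact_mod_cast h3

theorem norm_map_ofReal {V : Type*} [Fintype V] (M : Matrix V V ℝ) :
    ‖M.map (algebraMap ℝ ℂ)‖ = ‖M‖ := by
  simp [Matrix.linfty_opNorm_def]

theorem IsSchurStable.summable_norm_pow {V : Type*} [Fintype V] [DecidableEq V]
    {M : Matrix V V ℝ} (hM : IsSchurStable M) : Summable fun n => ‖M ^ n‖ := by
  cases isEmpty_or_nonempty V
  · have : ∀ n, M ^ n = 0 := fun n => Subsingleton.elim _ _
    simp [this, summable_zero]
  have h : spectralRadius ℂ (M.map (algebraMap ℝ ℂ)) < ((1 : NNReal) : ENNReal) := by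
    refine spectrum.spectralRadius_lt_of_forall_lt _ fun z hz => ?_
    rw [Matrix.mem_spectrum_iff_isRoot_charpoly] at hz
    exact hM z ((Polynomial.mem_roots (Matrix.charpoly_monic _).ne_zero).mpr hz)
  refine (summable_norm_pow_of_spectralRadius_lt_one h).congr fun n => ?_
  rw [← norm_map_ofReal (M ^ n), ← RingHom.mapMatrix_apply, ← RingHom.mapMatrix_apply, map_pow]

/-- Bounded-input bounded-state stability. -/
theorem IsSchurStable.exists_norm_le {V : Type*} [Fintype V] [DecidableEq V]
    {M : Matrix V V ℝ} (hM : IsSchurStable M) {x w : ℕ → V → ℝ}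
    (hx : ∀ t, x (t + 1) = M *ᵥ x t + w t) {W : ℝ} (hw : ∀ t, ‖w t‖ ≤ W) :
    ∃ C, ∀ t, ‖x t‖ ≤ C := by
  have hs := hM.summable_norm_pow
  have hsol : ∀ t, x t = M ^ t *ᵥ x 0 + ∑ s ∈ Finset.range t, M ^ s *ᵥ w (t - 1 - s) := by
    intro t
    induction t with
    | zero => simp
    | succ t ih =>
      rw [hx, ih, Finset.sum_range_succ', Matrix.mulVec_add, Matrix.mulVec_mulVec, ← pow_succ',
        Matrix.mulVec_sum, add_assoc]
      congr 2
      · refine Finset.sum_congr rfl fun s hs => ?_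
        rw [Matrix.mulVec_mulVec, ← pow_succ']
        congr 2
        omega
      · simp
  have hW : 0 ≤ W := (norm_nonneg _).trans (hw 0)
  have hle : ∀ t, ‖M ^ t‖ ≤ ∑' n, ‖M ^ n‖ := fun t =>
    hs.le_tsum t fun _ _ => norm_nonneg _
  refine ⟨(∑' n, ‖M ^ n‖) * ‖x 0‖ + (∑' n, ‖M ^ n‖) * W, fun t => ?_⟩
  rw [hsol t]
  refine (norm_add_le _ _).trans (add_le_add ?_ ?_)
  · refine (Matrix.linfty_opNorm_mulVec _ _).trans ?_
    gcongr
    exact hle t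
  · calc ‖∑ s ∈ Finset.range t, M ^ s *ᵥ w (t - 1 - s)‖
        ≤ ∑ s ∈ Finset.range t, ‖M ^ s‖ * W := by
          refine norm_sum_le_of_le _ fun s _ => ?_
          refine (Matrix.linfty_opNorm_mulVec _ _).trans ?_
          gcongr
          exact hw _
      _ ≤ (∑' n, ‖M ^ n‖) * W := by
          rw [← Finset.sum_mul]
          gcongr
          exact hs.sum_le_tsum _ fun _ _ => norm_nonneg _

theorem norm_le_sqrt_of_dotProduct_self_le {V : Type*} [Fintype V] {x : V → ℝ} {E : ℝ}
    (h : x ⬝ᵥ x ≤ E) : ‖x‖ ≤ √E := by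
  refine (pi_norm_le_iff_of_nonneg (Real.sqrt_nonneg _)).mpr fun i => Real.le_sqrt_of_sq_le ?_
  rw [Real.norm_eq_abs, sq_abs, sq]
  exact (Finset.single_le_sum (f := fun i => x i * x i) (fun i _ => mul_self_nonneg _)
    (Finset.mem_univ i)).trans h

theorem dotProduct_self_le_of_norm_le {V : Type*} [Fintype V] {x : V → ℝ} {C : ℝ} (h : ‖x‖ ≤ C) :
    x ⬝ᵥ x ≤ Fintype.card V * C ^ 2 := by
  have : x ⬝ᵥ x ≤ ∑ _i : V, C ^ 2 := by
    refine Finset.sum_le_sum fun i _ => ?_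
    rw [← sq, ← sq_abs]
    gcongr
    exact (norm_le_pi_norm x i).trans h
  simpa using this

/-- For a detectable pair, trajectories with bounded inputs and outputs are bounded. -/
theorem IsDetectable.exists_dotProduct_self_le {V W W' : Type*} [Fintype V] [DecidableEq V]
    [Fintype W] [Fintype W'] {A : Matrix V V ℝ} {C : Matrix W V ℝ} {B : Matrix V W' ℝ}
    (h : IsDetectable A C) {x : ℕ → V → ℝ} {u : ℕ → W' → ℝ}
    (hx : ∀ t, x (t + 1) = A *ᵥ x t + B *ᵥ u t) {E : ℝ}
    (hy : ∀ t, (C *ᵥ x t) ⬝ᵥ (C *ᵥ x t) ≤ E) (hu : ∀ t, u t ⬝ᵥ u t ≤ E) :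
    ∃ D, ∀ t, x t ⬝ᵥ x t ≤ D := by
  obtain ⟨L, hL⟩ := h
  -- Output injection: `x (t+1) = (A - L C) x t + (L C x t + B u t)`, a stable system with bounded
  -- forcing.
  obtain ⟨D, hD⟩ := hL.exists_norm_le (x := x) (w := fun t => L *ᵥ (C *ᵥ x t) + B *ᵥ u t)
    (W := ‖L‖ * √E + ‖B‖ * √E)
    (fun t => by
      rw [hx, Matrix.sub_mulVec, Matrix.mulVec_mulVec]
      abel)
    (fun t => by
      refine (norm_add_le _ _).trans (add_le_add ?_ ?_)
      · refine (Matrix.linfty_opNorm_mulVec _ _).trans ?_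
        gcongr
        exact norm_le_sqrt_of_dotProduct_self_le (hy t)
      · refine (Matrix.linfty_opNorm_mulVec _ _).trans ?_
        gcongr
        exact norm_le_sqrt_of_dotProduct_self_le (hu t))
  exact ⟨_, fun t => dotProduct_self_le_of_norm_le (hD t)⟩

end Stability

/-! ### Closed-loop cost. -/

/-- Completing the square with the gain `K = (1 + Bᵀ P B)⁻¹ Bᵀ P A`. -/
theorem SolvesRiccati.exists_feedback {V W : Type*} [Fintype V] [Fintype W] [DecidableEq W]
    {A Q P : Matrix V V ℝ} {B : Matrix V W ℝ} (hP : P.PosSemidef)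
    (h : SolvesRiccati A B Q 1 P) :
    ∃ K : Matrix W V ℝ, P = Q + Kᵀ * K + (A - B * K)ᵀ * P * (A - B * K) := by
  set G : Matrix W W ℝ := 1 + Bᵀ * P * B with hG
  have hGpos : G.PosDef := by
    refine Matrix.PosDef.one.add_posSemidef ?_
    simpa using hP.conjTranspose_mul_mul_same B
  have hdet : IsUnit G.det := hGpos.det_pos.ne'.isUnit
  set K : Matrix W V ℝ := G⁻¹ * Bᵀ * P * A with hK
  have hGK : G * K = Bᵀ * P * A := by
    rw [hK, Matrix.mul_assoc, Matrix.mul_assoc, Matrix.mul_nonsing_inv_cancel_left _ _ hdet,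
      Matrix.mul_assoc]
  have hKGK : Kᵀ * K + Kᵀ * (Bᵀ * P * B) * K = Kᵀ * (Bᵀ * P * A) := by
    rw [← hGK, hG, Matrix.add_mul, Matrix.one_mul, Matrix.mul_add, Matrix.mul_assoc Kᵀ]
  refine ⟨K, ?_⟩
  have hric : P = Q + Aᵀ * P * A - Aᵀ * P * B * K := by
    rw [SolvesRiccati, ← hG] at h
    rw [hK]
    simpa only [Matrix.mul_assoc] using h
  have hexp : (A - B * K)ᵀ * P * (A - B * K) =
      Aᵀ * P * A - Aᵀ * P * B * K - Kᵀ * (Bᵀ * P * A) + Kᵀ * (Bᵀ * P * B) * K := by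
    simp only [Matrix.transpose_sub, Matrix.transpose_mul, Matrix.mul_sub, Matrix.sub_mul,
      Matrix.mul_assoc]
    abel
  conv_lhs => rw [hric]
  rw [hexp, ← hKGK]
  abel

/-- The optimal trajectory from `x₀`, whose accumulated cost is at most `x₀ᵀ P x₀`. -/
theorem SolvesRiccati.exists_trajectory {V W : Type*} [Fintype V] [Fintype W] [DecidableEq W]
    {A Q P : Matrix V V ℝ} {B : Matrix V W ℝ} (hP : P.PosSemidef)
    (h : SolvesRiccati A B Q 1 P) (x₀ : V → ℝ) :
    ∃ (x : ℕ → V → ℝ) (u : ℕ → W → ℝ), x 0 = x₀ ∧ (∀ t, x (t + 1) = A *ᵥ x t + B *ᵥ u t) ∧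
      ∀ N, ∑ t ∈ Finset.range N, (x t ⬝ᵥ Q *ᵥ x t + u t ⬝ᵥ u t) ≤ x₀ ⬝ᵥ P *ᵥ x₀ := by
  obtain ⟨K, hK⟩ := h.exists_feedback hP
  let x : ℕ → V → ℝ := fun t => Nat.rec x₀ (fun _ y => (A - B * K) *ᵥ y) t
  have hxs : ∀ t, x (t + 1) = (A - B * K) *ᵥ x t := fun t => rfl
  refine ⟨x, fun t => -(K *ᵥ x t), rfl, fun t => ?_, fun N => ?_⟩
  · rw [hxs, Matrix.sub_mulVec, Matrix.mulVec_neg, Matrix.mulVec_mulVec, sub_eq_add_neg]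
  · have step : ∀ y : V → ℝ, y ⬝ᵥ P *ᵥ y = y ⬝ᵥ Q *ᵥ y + -(K *ᵥ y) ⬝ᵥ -(K *ᵥ y) +
        ((A - B * K) *ᵥ y) ⬝ᵥ P *ᵥ ((A - B * K) *ᵥ y) := fun y => by
      conv_lhs => rw [hK]
      rw [neg_dotProduct_neg, Matrix.add_mulVec, Matrix.add_mulVec, dotProduct_add, dotProduct_add,
        ← Matrix.mulVec_mulVec, ← Matrix.mulVec_mulVec, ← Matrix.mulVec_mulVec,
        Matrix.dotProduct_mulVec y Kᵀ, Matrix.vecMul_transpose,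
        Matrix.dotProduct_mulVec y (A - B * K)ᵀ, Matrix.vecMul_transpose]
    -- The cost telescopes exactly; the terminal term is nonnegative and can be dropped, so any
    -- positive semidefinite solution `P` will do.
    have key : ∑ t ∈ Finset.range N, (x t ⬝ᵥ Q *ᵥ x t + -(K *ᵥ x t) ⬝ᵥ -(K *ᵥ x t)) +
        x N ⬝ᵥ P *ᵥ x N = x₀ ⬝ᵥ P *ᵥ x₀ := by
      induction N with
      | zero => simp [x]
      | succ N ih => rw [Finset.sum_range_succ, hxs, ← ih, step (x N)]; ring
    rw [← key]
    have := hP.dotProduct_mulVec_nonneg (x N)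
    simp only [star_trivial] at this
    linarith

/-! ### Duality with the backward orbit. -/

/-- The cost of steering to bounded states is bounded from below along a decaying adjoint
trajectory `z` which sees the input only from time `T` on. -/
theorem sq_dotProduct_le_of_adjoint_trajectory {V W : Type*} [Fintype V] [Fintype W]
    {A : Matrix V V ℝ} {B : Matrix V W ℝ} (hA : A.IsSymm) {x z : ℕ → V → ℝ} {u : ℕ → W → ℝ}
    {T : ℕ} {q c D E : ℝ} (hq0 : 0 < q) (hq1 : q < 1)
    (hx : ∀ t, x (t + 1) = A *ᵥ x t + B *ᵥ u t) (hz : ∀ t, A *ᵥ z (t + 1) = z t)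
    (hBT : ∀ t < T, Bᵀ *ᵥ z (t + 1) = 0)
    (hB : ∀ a : V → ℝ, (Bᵀ *ᵥ a) ⬝ᵥ (Bᵀ *ᵥ a) ≤ a ⬝ᵥ a)
    (hc : ∀ t, z t ⬝ᵥ z t ≤ q ^ t * c) (hD : ∀ t, x t ⬝ᵥ x t ≤ D)
    (hE : ∀ N, ∑ t ∈ Finset.range N, u t ⬝ᵥ u t ≤ E) :
    (z 0 ⬝ᵥ x 0) ^ 2 ≤ q ^ (T + 1) / (1 - q) * c * E := by
  have hc0 : 0 ≤ c := by
    have := hc 0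
    rw [pow_zero, one_mul] at this
    exact (by simpa using dotProduct_star_self_nonneg (z 0) : (0 : ℝ) ≤ z 0 ⬝ᵥ z 0).trans this
  have htel : ∀ N, z N ⬝ᵥ x N - z 0 ⬝ᵥ x 0 =
      ∑ t ∈ Finset.range N, (Bᵀ *ᵥ z (t + 1)) ⬝ᵥ u t := by
    intro N
    rw [← Finset.sum_range_sub (fun t => z t ⬝ᵥ x t)]
    refine Finset.sum_congr rfl fun t _ => ?_
    have h1 : z (t + 1) ⬝ᵥ A *ᵥ x t = z t ⬝ᵥ x t := by
      rw [Matrix.dotProduct_mulVec, ← Matrix.mulVec_transpose, hA.eq, hz]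
    have h2 : z (t + 1) ⬝ᵥ B *ᵥ u t = (Bᵀ *ᵥ z (t + 1)) ⬝ᵥ u t := by
      rw [Matrix.dotProduct_mulVec, ← Matrix.mulVec_transpose]
    rw [hx, dotProduct_add, h1, h2]
    ring
  have hsum : ∀ N, ∑ t ∈ Finset.range N, (Bᵀ *ᵥ z (t + 1)) ⬝ᵥ (Bᵀ *ᵥ z (t + 1)) ≤
      q ^ (T + 1) / (1 - q) * c := by
    intro N
    calc ∑ t ∈ Finset.range N, (Bᵀ *ᵥ z (t + 1)) ⬝ᵥ (Bᵀ *ᵥ z (t + 1))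
        ≤ ∑ t ∈ Finset.range (T + N), (Bᵀ *ᵥ z (t + 1)) ⬝ᵥ (Bᵀ *ᵥ z (t + 1)) :=
          Finset.sum_le_sum_of_subset_of_nonneg
            (Finset.range_subset_range.mpr (Nat.le_add_left N T)) fun t _ _ => by
              simpa using dotProduct_star_self_nonneg (Bᵀ *ᵥ z (t + 1))
      _ = ∑ t ∈ Finset.range N, (Bᵀ *ᵥ z (T + t + 1)) ⬝ᵥ (Bᵀ *ᵥ z (T + t + 1)) := by
          rw [Finset.sum_range_add, Finset.sum_eq_zero, zero_add]
          intro t ht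
          rw [hBT t (Finset.mem_range.mp ht), zero_dotProduct]
      _ ≤ ∑ t ∈ Finset.range N, q ^ (T + t + 1) * c :=
          Finset.sum_le_sum fun t _ => (hB _).trans (hc _)
      _ = (∑ t ∈ Finset.range N, q ^ t) * (q ^ (T + 1) * c) := by
          rw [Finset.sum_mul]
          exact Finset.sum_congr rfl fun t _ => by ring
      _ ≤ (1 - q)⁻¹ * (q ^ (T + 1) * c) := by
          gcongr
          rw [← tsum_geometric_of_lt_one hq0.le hq1]
          exact (summable_geometric_of_lt_one hq0.le hq1).sum_le_tsum _ fun _ _ => by positivity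
      _ = q ^ (T + 1) / (1 - q) * c := by ring
  have hCS : ∀ N, (z N ⬝ᵥ x N - z 0 ⬝ᵥ x 0) ^ 2 ≤ q ^ (T + 1) / (1 - q) * c * E := by
    intro N
    have hE0 : 0 ≤ E := by simpa using hE 0
    have h1q : 0 < 1 - q := sub_pos.mpr hq1
    -- A single Cauchy–Schwarz over all pairs (time, input coordinate).
    have h := Finset.sum_mul_sq_le_sq_mul_sq (Finset.range N ×ˢ (Finset.univ : Finset W))
      (fun p => (Bᵀ *ᵥ z (p.1 + 1)) p.2) (fun p => u p.1 p.2)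
    simp only [Finset.sum_product, sq (_ : ℝ)] at h
    rw [htel, sq]
    exact h.trans (mul_le_mul (hsum N) (hE N)
      (Finset.sum_nonneg fun t _ => Finset.sum_nonneg fun _ _ => mul_self_nonneg _)
      (by positivity))
  have hlim : Tendsto (fun N => z N ⬝ᵥ x N) atTop (𝓝 0) := by
    have hsq : Tendsto (fun N => (z N ⬝ᵥ x N) ^ 2) atTop (𝓝 0) := by
      refine squeeze_zero (fun _ => sq_nonneg _) (g := fun N => q ^ N * (c * D)) (fun N => ?_) ?_
      · have h := Finset.sum_mul_sq_le_sq_mul_sq (Finset.univ : Finset V) (z N) (x N)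
        simp only [sq (_ : ℝ)] at h
        rw [sq, ← mul_assoc]
        exact h.trans (mul_le_mul (hc N) (hD N)
          (Finset.sum_nonneg fun _ _ => mul_self_nonneg _) (by positivity))
      · simpa using (tendsto_pow_atTop_nhds_zero_of_lt_one hq0.le hq1).mul_const (c * D)
    rw [tendsto_zero_iff_abs_tendsto_zero]
    simpa [Function.comp_def, Real.sqrt_sq_eq_abs] using hsq.sqrt
  have hl2 := (hlim.sub_const (z 0 ⬝ᵥ x 0)).pow 2
  simpa using le_of_tendsto' hl2 hCS

/-! ### Hiding an orbit from the actuators. -/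

theorem transpose_inputMatrix_mulVec {V : Type*} [Fintype V] [DecidableEq V] (S : Finset V)
    (a : V → ℝ) (j : S) : ((inputMatrix S)ᵀ *ᵥ a) j = a j := by
  simp [inputMatrix, Matrix.mulVec, dotProduct]

theorem dotProduct_transpose_inputMatrix_mulVec_le {V : Type*} [Fintype V] [DecidableEq V]
    (S : Finset V) (a : V → ℝ) :
    ((inputMatrix S)ᵀ *ᵥ a) ⬝ᵥ ((inputMatrix S)ᵀ *ᵥ a) ≤ a ⬝ᵥ a := by
  simp only [dotProduct, transpose_inputMatrix_mulVec]
  rw [Finset.sum_coe_sort S fun j => a j * a j]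
  exact Finset.sum_le_univ_sum_of_nonneg fun _ => mul_self_nonneg _

/-- A vector in the span of the eigenvectors `v i`, `i ∈ I`, whose backward orbit is invisible to
`S` for the first `T` steps. -/
theorem exists_combination_eq_zero_on {V : Type*} [Fintype V] (S I : Finset V) (T : ℕ)
    (hT : T * S.card < I.card) (l : V → ℝ) (v : V → V → ℝ) :
    ∃ c : I → ℝ, c ≠ 0 ∧
      ∀ t < T, ∀ j ∈ S, (∑ i : I, (c i * (l i)⁻¹ ^ (t + 1)) • v i) j = 0 := by
  let f : (I → ℝ) →ₗ[ℝ] (Fin T × S → ℝ) :=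
    { toFun := fun c p => (∑ i : I, (c i * (l i)⁻¹ ^ (p.1.val + 1)) • v i) p.2
      map_add' := fun c d => by
        ext p
        simp [add_mul, Finset.sum_add_distrib]
      map_smul' := fun a c => by
        ext p
        simp [Finset.mul_sum, mul_assoc] }
  -- There are `T * S.card` equations in `I.card` unknowns.
  have hf : LinearMap.ker f ≠ ⊥ := LinearMap.ker_ne_bot_of_finrank_lt (by simpa using hT)
  obtain ⟨c, hc, hc0⟩ := Submodule.exists_mem_ne_zero_of_ne_bot hf
  exact ⟨c, hc0, fun t ht j hj => congrFun (LinearMap.mem_ker.mp hc) (⟨t, ht⟩, ⟨j, hj⟩)⟩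

/-! ### The lower bounds on the cost matrix. -/

/-- The duality estimate with `x 0 = z 0`, `q = r⁻²` and energy `lP * e`, where `e = |z 0|²`, reads
`e² ≤ q^(T+1) / (1 - q) * e * (lP * e)`; cancel `e²`. -/
theorem le_maxEigenvalue_of_card_mul_lt {V : Type*} [Fintype V] [DecidableEq V]
    {A Q P : Matrix V V ℝ} {S : Finset V} (hA : A.IsSymm) (hQ : Q.PosSemidef)
    (hdet : IsDetectable A (CFC.sqrt Q)) (hP : P.PosSemidef)
    (hric : SolvesRiccati A (inputMatrix S) Q 1 P) {lP : ℝ} (hlP : IsMaxEigenvalue P lP)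
    {l : V → ℝ} {v : V → V → ℝ} (hl : ∀ i, A *ᵥ v i = l i • v i)
    (hv : ∀ i j, v i ⬝ᵥ v j = if i = j then 1 else 0) {r : ℝ} (hr : 1 < r) {I : Finset V}
    (hI : ∀ i ∈ I, r ≤ |l i|) {T : ℕ} (hT : T * S.card < I.card) :
    (r ^ 2 - 1) * r ^ (2 * T) ≤ lP := by
  obtain ⟨c, hc0, hc⟩ := exists_combination_eq_zero_on S I T hT l v
  have hr0 : 0 < r := one_pos.trans hr
  have hl0 : ∀ i : I, l i ≠ 0 := fun i h => by
    have := hI i i.2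
    rw [h, abs_zero] at this
    linarith
  set z : ℕ → V → ℝ := fun t => ∑ i : I, (c i * (l i)⁻¹ ^ t) • v i with hz
  have hzz : ∀ t, z t ⬝ᵥ z t = ∑ i : I, (c i * (l i)⁻¹ ^ t) ^ 2 := fun t => by
    simp only [hz, sum_dotProduct, dotProduct_sum, smul_dotProduct, dotProduct_smul, hv,
      Subtype.coe_inj, smul_eq_mul, mul_ite, mul_one, mul_zero, Finset.sum_ite_eq',
      Finset.mem_univ, if_true, sq]
  have hAz : ∀ t, A *ᵥ z (t + 1) = z t := fun t => by
    simp only [hz, Matrix.mulVec_sum, Matrix.mulVec_smul, hl, smul_smul]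
    refine Finset.sum_congr rfl fun i _ => ?_
    rw [pow_succ, mul_assoc, mul_assoc, inv_mul_cancel₀ (hl0 i), mul_one]
  set e : ℝ := z 0 ⬝ᵥ z 0 with he
  have he' : e = ∑ i : I, c i ^ 2 := by simp [he, hzz]
  have hepos : 0 < e := by
    rw [he']
    obtain ⟨i, hi⟩ := Function.ne_iff.mp hc0
    exact Finset.sum_pos' (fun _ _ => sq_nonneg _) ⟨i, Finset.mem_univ i, sq_pos_of_ne_zero hi⟩
  have hdec : ∀ t, z t ⬝ᵥ z t ≤ ((r ^ 2)⁻¹) ^ t * e := fun t => by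
    rw [hzz, he', Finset.mul_sum]
    refine Finset.sum_le_sum fun i _ => ?_
    rw [mul_pow, mul_comm, ← pow_mul, mul_comm t, pow_mul, inv_pow, ← sq_abs (l i)]
    gcongr
    exact hI i i.2
  obtain ⟨x, u, hx0, hx, hcost⟩ := hric.exists_trajectory hP (z 0)
  have hxQ : ∀ t, 0 ≤ x t ⬝ᵥ Q *ᵥ x t := fun t => by
    simpa using hQ.dotProduct_mulVec_nonneg (x t)
  have huu : ∀ t, 0 ≤ u t ⬝ᵥ u t := fun t => by simpa using dotProduct_star_self_nonneg (u t)
  have hE : ∀ N, ∑ t ∈ Finset.range N, (x t ⬝ᵥ Q *ᵥ x t + u t ⬝ᵥ u t) ≤ lP * e := fun N =>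
    (hcost N).trans (dotProduct_mulVec_le_of_isMaxEigenvalue hP hlP (z 0))
  have hE1 : ∀ t, x t ⬝ᵥ Q *ᵥ x t + u t ⬝ᵥ u t ≤ lP * e := fun t =>
    (Finset.single_le_sum (f := fun t => x t ⬝ᵥ Q *ᵥ x t + u t ⬝ᵥ u t)
      (fun s _ => add_nonneg (hxQ s) (huu s)) (Finset.self_mem_range_succ t)).trans (hE (t + 1))
  have hsqrt : ∀ a : V → ℝ, (CFC.sqrt Q *ᵥ a) ⬝ᵥ (CFC.sqrt Q *ᵥ a) = a ⬝ᵥ Q *ᵥ a := fun a => by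
    have hs : (CFC.sqrt Q)ᵀ = CFC.sqrt Q := by
      have h : IsSelfAdjoint (CFC.sqrt Q) := IsSelfAdjoint.of_nonneg (CFC.sqrt_nonneg Q)
      rw [← Matrix.conjTranspose_eq_transpose_of_trivial]
      exact h
    conv_rhs => rw [← CFC.sqrt_mul_sqrt_self Q hQ.nonneg]
    rw [← Matrix.mulVec_mulVec, Matrix.dotProduct_mulVec a, ← Matrix.mulVec_transpose, hs]
  obtain ⟨D, hD⟩ := hdet.exists_dotProduct_self_le hx (E := lP * e)
    (fun t => by rw [hsqrt]; linarith [hE1 t, huu t]) (fun t => by linarith [hE1 t, hxQ t])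
  have hq1 : (r ^ 2)⁻¹ < 1 := inv_lt_one_of_one_lt₀ (one_lt_pow₀ hr two_ne_zero)
  have hkey := sq_dotProduct_le_of_adjoint_trajectory hA (by positivity) hq1 hx hAz
    (T := T) (fun t ht => by
      ext j
      rw [transpose_inputMatrix_mulVec]
      exact hc t ht j j.2)
    (dotProduct_transpose_inputMatrix_mulVec_le S) hdec hD
    (fun N => (Finset.sum_le_sum fun t _ => le_add_of_nonneg_left (hxQ t)).trans (hE N))
  rw [hx0, ← he] at hkey
  have hr1 : 0 < r ^ 2 - 1 := sub_pos.mpr (one_lt_pow₀ hr two_ne_zero)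
  have hfac : ((r ^ 2)⁻¹) ^ (T + 1) / (1 - (r ^ 2)⁻¹) = ((r ^ 2 - 1) * r ^ (2 * T))⁻¹ := by
    have : 1 - (r ^ 2)⁻¹ = (r ^ 2 - 1) / r ^ 2 := by field_simp
    rw [this, pow_mul, inv_pow, pow_succ]
    field_simp
  rw [hfac] at hkey
  have h2 : e ^ 2 * 1 ≤ e ^ 2 * (((r ^ 2 - 1) * r ^ (2 * T))⁻¹ * lP) := by
    calc e ^ 2 * 1 = e ^ 2 := mul_one _
      _ ≤ _ := hkey
      _ = _ := by ring
  have h3 := le_of_mul_le_mul_left h2 (by positivity)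
  rwa [inv_mul_eq_div, one_le_div (by positivity)] at h3

theorem corollary1 {V : Type*} [Fintype V] [DecidableEq V]
    (A Q P : Matrix V V ℝ) (S : Finset V) (hS : S.Nonempty)
    (hA : A.IsSymm) (hunst : IsSchurUnstable A)
    (hQ : Q.PosSemidef) (hdet : IsDetectable A (CFC.sqrt Q))
    (hP : P.PosSemidef) (hric : SolvesRiccati A (inputMatrix S) Q 1 P)
    (lmax lu lP : ℝ) (hlmax : IsMaxEigenvalue A lmax)
    (hlu : IsMinUnstableEigenvalue A lu) (hlP : IsMaxEigenvalue P lP) :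
    max ((lmax ^ 2 - 1) / lmax ^ 2)
      ((lu ^ 2 - 1) / lu ^ 2 *
        |lu| ^ (2 * ((numEigenvaluesGE A |lu| : ℝ) / (S.card : ℝ) - 1))) ≤ lP := by
  have hH : A.IsHermitian := (Matrix.conjTranspose_eq_transpose_of_trivial A).trans hA
  obtain ⟨l, v, hl, hv, -, hs⟩ := exists_orthonormal_eigenvectors hH
  have key := fun (r : ℝ) (hr : 1 < r) (I : Finset V) (hI : ∀ i ∈ I, r ≤ |l i|) (T : ℕ) =>
    le_maxEigenvalue_of_card_mul_lt hA hQ hdet hP hric hlP hl hv hr hI (T := T)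
  have hmem : ∀ a : ℝ, (a : ℂ) ∈ spec A → ∃ i, l i = a := fun a ha => by
    rw [hs] at ha
    obtain ⟨i, -, hi⟩ := Multiset.mem_map.mp ha
    exact ⟨i, by exact_mod_cast hi⟩
  -- The estimate gives `a² - 1`; the stated factor is weaker by `a⁻²`.
  have hdiv : ∀ a : ℝ, 1 < |a| → (a ^ 2 - 1) / a ^ 2 ≤ |a| ^ 2 - 1 := fun a ha => by
    have : 1 < |a| ^ 2 := one_lt_pow₀ ha two_ne_zero
    rw [sq_abs] at this ⊢
    exact div_le_self (by linarith) this.le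
  refine max_le ?_ ?_
  · obtain ⟨w, hw, hw1⟩ := hunst
    have hm1 : 1 < |lmax| := hw1.trans_le (hlmax.2 w hw)
    obtain ⟨i, hi⟩ := hmem lmax hlmax.1
    -- One eigenvector and no hidden steps suffice here.
    have h := key |lmax| hm1 {i} (by simp [hi]) 0 (by simp)
    rw [mul_zero, pow_zero, mul_one] at h
    exact (hdiv lmax hm1).trans h
  · have hn : numEigenvaluesGE A |lu| = (Finset.univ.filter fun i => |lu| ≤ |l i|).card := by
      rw [numEigenvaluesGE, hs, Multiset.filter_map, Multiset.card_map]
      simp only [Function.comp_def, Complex.norm_real, Real.norm_eq_abs]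
      rfl
    obtain ⟨i, hi⟩ := hmem lu hlu.1
    have hSpos : 0 < S.card := hS.card_pos
    have hSpos' : (0 : ℝ) < S.card := by exact_mod_cast hSpos
    set n := numEigenvaluesGE A |lu|
    have hnpos : 0 < n := by
      rw [hn]
      exact Finset.card_pos.mpr ⟨i, by simp [hi]⟩
    have hlu1 : 1 < |lu| := hlu.2.1
    -- `(n - 1) / S.card`, rounded down, is the largest `T` with `T * S.card < n`; it is at least `n
    -- / |S| - 1`.
    have h := key |lu| hlu1 (Finset.univ.filter fun i => |lu| ≤ |l i|) (by simp)
      ((n - 1) / S.card) (by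
        rw [← hn]
        exact (Nat.div_mul_le_self _ _).trans_lt (Nat.sub_lt hnpos one_pos))
    have hexp : (n : ℝ) / S.card - 1 ≤ ((n - 1) / S.card : ℕ) := by
      rw [sub_le_iff_le_add, div_le_iff₀ hSpos']
      have h' := Nat.lt_mul_of_div_lt (Nat.lt_add_one ((n - 1) / S.card)) hSpos
      exact_mod_cast Nat.le_of_pred_lt h'
    refine le_trans ?_ h
    refine mul_le_mul (hdiv lu hlu1) ?_ (by positivity)
      (sub_nonneg.mpr (one_le_pow₀ hlu1.le))
    rw [← Real.rpow_natCast]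
    refine Real.rpow_le_rpow_of_exponent_le hlu1.le ?_
    push_cast at hexp ⊢
    linarith
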